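/- Let $F$ be a finite-dimensional real inner product space (for example $F=\mathbb{R}$ or $F=\mathbb{R}^m$), and let $f\in \hat W^{1,2}(\mathbb{R}^2)$ be $F$-valued, that is, $f\in W^{1,2}_{\rm loc}(\mathbb{R}^2;F)$ and its weak gradient $\nabla f=(\partial_1 f,\partial_2 f)$ belongs to $L^2(\mathbb{R}^2)$. Write $|\nabla f|^2=|\partial_1 f|^2+|\partial_2 f|^2$, and for a ball $B$ let $(f)_B=\frac1{|B|}\int_B f$ be the mean value of $f$ on $B$. Let $\mu\in(0,1)$ and let $c_0,c_1>0$ be constants. Suppose that for every $x_0\in\mathbb{R}^2$ and every $0<r<\frac12$, with $B_\rho=B_\rho(x_0)$, $$\int_{B_{r/2}}|\nabla f|^2\,dx\;\le\; c_0\bigl(1+|(f)_{B_r}|\bigr)\int_{B_r\setminus B_{r/2}}|\nabla f|^2\,dx+c_1r^{\mu}.$$ Then $f$ is (locally) Hölder continuous on $\mathbb{R}^2$: $f$ agrees almost everywhere with a function $g:\mathbb{R}^2\to F$ such that for every compact $K\subset\mathbb{R}^2$ there are $\alpha\in(0,1]$ and $C\ge 0$ with $|g(x)-g(y)|\le C|x-y|^{\alpha}$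 for all $x,y\in K$. -/

import Mathlib

open MeasureTheory Metric
open scoped NNReal ContDiff

/-- The Euclidean plane. -/
abbrev Plane : Type := EuclideanSpace ℝ (Fin 2)

section HatSobolev

variable {F : Type*} [NormedAddCommGroup F] [InnerProductSpace ℝ F]

/-- `f` is locally square integrable on the plane. -/
def MemL2Loc (f : Plane → F) : Prop :=
  ∀ K : Set Plane, IsCompact K → MemLp f 2 (volume.restrict K)

/-- `g` is the weak partial derivative of `f` in the `i`-th coordinate direction: both are locally
integrable and `∫ (∂ᵢφ) f = - ∫ φ g` for all real test functions `φ` of class `C_c^∞`. -/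
def HasWeakPartial (i : Fin 2) (f g : Plane → F) : Prop :=
  LocallyIntegrable f volume ∧ LocallyIntegrable g volume ∧
    ∀ φ : Plane → ℝ, ContDiff ℝ ∞ φ → HasCompactSupport φ →
      ∫ x, (fderiv ℝ φ x (EuclideanSpace.single i 1)) • f x = - ∫ x, φ x • g x

/-- `G = (G 0, G 1)` is (a version of) the weak gradient of `f`. -/
def IsWeakGradient (f : Plane → F) (G : Fin 2 → Plane → F) : Prop :=
  ∀ i, HasWeakPartial i f (G i)

/-- The space of all `f ∈ W^{1,2}_loc` on the plane whose weak gradient is globally square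
integrable. -/
def MemHatW12 (f : Plane → F) : Prop :=
  MemL2Loc f ∧ ∃ G : Fin 2 → Plane → F, IsWeakGradient f G ∧ ∀ i, MemLp (G i) 2 volume

/-- The squared Euclidean (Hilbert-Schmidt) norm `|G|² = |G 0|² + |G 1|²` of a gradient field. -/
def gradSq (G : Fin 2 → Plane → F) (x : Plane) : ℝ :=
  ∑ i, ‖G i x‖ ^ 2

/-- Local Hölder continuity on the plane: on each compact set `g` is Hölder continuous with some
exponent in `(0, 1]`. -/
def IsLocallyHolder (g : Plane → F) : Prop :=
  ∀ K : Set Plane, IsCompact K →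
    ∃ C α : ℝ≥0, 0 < α ∧ α ≤ 1 ∧ HolderOnWith C α g K

end HatSobolev

/-! ### Weak gradients and translations -/

section WeakGradient

variable {F : Type*} [NormedAddCommGroup F]

/-! Fix a centre x and dyadic radii r_k = r₀ 2^(-k). Let d_k be the Dirichlet integral over
B_{r_k}(x) and m_k the norm of the mean of f there. Adding c₀(1 + m_k) d_{k+1} to both sides of the
hypothesis (hole filling) gives N_k d_{k+1} ≤ (N_k - 1) d_k + c q^k with N_k = 1 + c₀(1 + m_k) and q
= 2^(-μ). If N_k were bounded, d_k would decay geometrically, and Morrey's argument would give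
Hölder continuity. The difficulty is that the means of a W^{1,2} function in the plane may be
unbounded.

The way out is a two-pass bootstrap (`exists_geometric_decay_of_hole_filling`). Passing to the next
radius changes the mean by at most 9√d_k (`norm_setAverage_ball_half_sub_le`). By absolute
continuity of the integral, d_k ≤ ε for all centres once r₀ is small, so N_k grows at most linearly,
with slope as small as desired. With slope 1/5 the factors 1 - 1/N_k still force d_k = O(k^(-4))
(`exists_polynomial_decay`). Then √d_k = O(k^(-2)) is summable, the means are bounded after all, and
a second pass with bounded N_k gives geometric decay (`exists_geometric_decay`).

All constants depend on the centre only through bounds for the means at two fixed scales. These are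
locally uniform, as `exists_isLocallyHolder_of_gradSq_decay` requires. -/

theorem MemL2Loc.locallyIntegrable {f : Plane → F} (hf : MemL2Loc f) :
    LocallyIntegrable f volume := by
  rw [locallyIntegrable_iff]
  intro K hK
  have : IsFiniteMeasure (volume.restrict K) := ⟨by simpa using hK.measure_lt_top⟩
  exact (hf K hK).integrable (by norm_num)

theorem gradSq_nonneg (G : Fin 2 → Plane → F) (x : Plane) : 0 ≤ gradSq G x :=
  Finset.sum_nonneg fun _ _ => by positivity

theorem integrable_gradSq {G : Fin 2 → Plane → F} (hG : ∀ i, MemLp (G i) 2 volume) :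
    Integrable (gradSq G) volume :=
  integrable_finsetSum _ fun i _ => (hG i).integrable_norm_pow (by norm_num)

theorem memLp_sqrt_gradSq {G : Fin 2 → Plane → F} (hG : ∀ i, MemLp (G i) 2 volume) :
    MemLp (fun z => √(gradSq G z)) 2 volume := by
  rw [memLp_two_iff_integrable_sq]
  · simpa [Real.sq_sqrt (gradSq_nonneg G _)] using integrable_gradSq hG
  · exact Real.continuous_sqrt.comp_aestronglyMeasurable
      (integrable_gradSq hG).aestronglyMeasurable

variable [InnerProductSpace ℝ F]

theorem HasWeakPartial.ae_eq [CompleteSpace F] {i : Fin 2} {f g g' : Plane → F}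
    (h : HasWeakPartial i f g) (h' : HasWeakPartial i f g') : g =ᵐ[volume] g' := by
  refine ae_eq_of_integral_contDiff_smul_eq h.2.1 h'.2.1 fun φ hφ hc => ?_
  have := (h.2.2 φ hφ hc).symm.trans (h'.2.2 φ hφ hc)
  exact neg_injective this

theorem IsWeakGradient.memLp [CompleteSpace F] {f : Plane → F} (hf : MemHatW12 f)
    {G : Fin 2 → Plane → F} (hG : IsWeakGradient f G) (i : Fin 2) : MemLp (G i) 2 volume := by
  obtain ⟨-, G', hG', h⟩ := hf
  exact (memLp_congr_ae ((hG i).ae_eq (hG' i))).2 (h i)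

theorem norm_sum_smul_le_sqrt_gradSq (G : Fin 2 → Plane → F) (h x : Plane) :
    ‖∑ i, h i • G i x‖ ≤ ‖h‖ * √(gradSq G x) := by
  calc ‖∑ i, h i • G i x‖ ≤ ∑ i, |h i| * ‖G i x‖ := by
        refine (norm_sum_le _ _).trans_eq ?_
        simp [norm_smul]
    _ ≤ √(∑ i, |h i| ^ 2) * √(∑ i, ‖G i x‖ ^ 2) := Real.sum_mul_le_sqrt_mul_sqrt _ _ _
    _ = ‖h‖ * √(gradSq G x) := by simp [EuclideanSpace.norm_eq, gradSq]

theorem hasDerivAt_integral_translate_smul {f : Plane → F} (hf : LocallyIntegrable f volume)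
    {φ : Plane → ℝ} (hφ : ContDiff ℝ ∞ φ) (hc : HasCompactSupport φ) (h : Plane) (t : ℝ) :
    HasDerivAt (fun t : ℝ => ∫ z, φ (z - t • h) • f z)
      (∫ z, (-(fderiv ℝ φ (z - t • h) h)) • f z) t := by
  have hcd : HasCompactSupport (fderiv ℝ φ) := hc.fderiv ℝ
  have hdc : Continuous (fderiv ℝ φ) := hφ.continuous_fderiv (by simp)
  obtain ⟨C, hC⟩ := hcd.exists_bound_of_continuous hdc
  obtain ⟨R, hR⟩ := hcd.isCompact.isBounded.subset_closedBall 0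
  have hC0 : 0 ≤ C := (norm_nonneg _).trans (hC 0)
  -- Contains the support of the derivative of every translate of φ by s • h with |s - t| < 1, so
  -- one dominating function serves all such s.
  set K : Set Plane := closedBall 0 (R + (|t| + 1) * ‖h‖) with hK
  have hfm := hf.aestronglyMeasurable
  have hcomp : ∀ s : ℝ, Continuous fun z : Plane => z - s • h := fun s => by fun_prop
  refine (hasDerivAt_integral_of_dominated_loc_of_deriv_le (s := ball t 1)
    (bound := K.indicator fun z => C * ‖h‖ * ‖f z‖)
    (F' := fun s z => (-(fderiv ℝ φ (z - s • h) h)) • f z)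
    (ball_mem_nhds t one_pos) (.of_forall fun s => ?_) ?_ ?_ (.of_forall fun z s hs => ?_) ?_
    (.of_forall fun z s _ => ?_)).2
  · exact (hφ.continuous.comp (hcomp s)).aestronglyMeasurable.smul hfm
  · exact hf.integrable_smul_left_of_hasCompactSupport (hφ.continuous.comp (hcomp t))
      (hc.comp_homeomorph (Homeomorph.subRight (t • h)))
  · exact (((hdc.comp (hcomp t)).clm_apply continuous_const).neg).aestronglyMeasurable.smul hfm
  · by_cases hz : z ∈ K
    · rw [Set.indicator_of_mem hz, norm_smul, norm_neg]
      gcongr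
      exact ((fderiv ℝ φ (z - s • h)).le_opNorm h).trans (by gcongr; exact hC _)
    · have h0 : fderiv ℝ φ (z - s • h) = 0 := by
        by_contra hne
        have h1 := hR (subset_tsupport _ hne)
        apply hz
        rw [mem_closedBall_zero_iff] at h1 ⊢
        have h2 : |s| ≤ |t| + 1 := by
          rw [mem_ball, Real.dist_eq] at hs
          have := abs_sub_abs_le_abs_sub s t
          linarith
        calc ‖z‖ = ‖(z - s • h) + s • h‖ := by simp
          _ ≤ ‖z - s • h‖ + ‖s • h‖ := norm_add_le _ _
          _ ≤ R + (|t| + 1) * ‖h‖ := by rw [norm_smul, Real.norm_eq_abs]; gcongr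
      simp [h0, Set.indicator_of_notMem hz]
  · rw [integrable_indicator_iff isClosed_closedBall.measurableSet]
    exact ((hf.integrableOn_isCompact (isCompact_closedBall _ _)).norm).const_mul _
  · have h1 : HasDerivAt (fun s : ℝ => z - s • h) (-h) s := by
      simpa using ((hasDerivAt_id s).smul_const h).const_sub z
    have h2 : HasFDerivAt φ (fderiv ℝ φ (z - s • h)) (z - s • h) :=
      (hφ.differentiable (by simp) _).hasFDerivAt
    simpa using (h2.comp_hasDerivAt s h1).smul_const (f z)

theorem IsWeakGradient.integral_fderiv_smul {f : Plane → F} {G : Fin 2 → Plane → F}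
    (hG : IsWeakGradient f G) {φ : Plane → ℝ} (hφ : ContDiff ℝ ∞ φ) (hc : HasCompactSupport φ)
    (h : Plane) :
    ∫ z, (-(fderiv ℝ φ z h)) • f z = ∫ z, φ z • ∑ i, h i • G i z := by
  have hh : h = ∑ i, h i • EuclideanSpace.single i (1 : ℝ) := by
    ext j
    fin_cases j <;> simp
  have e1 : ∀ z, (-(fderiv ℝ φ z h)) • f z
      = ∑ i, (-h i) • ((fderiv ℝ φ z (EuclideanSpace.single i 1)) • f z) := by
    intro z
    conv_lhs => rw [hh]
    simp [smul_smul, add_smul]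
  have e2 : ∀ z, φ z • ∑ i, h i • G i z = ∑ i, h i • (φ z • G i z) := by
    intro z
    rw [Finset.smul_sum]
    exact Finset.sum_congr rfl fun i _ => smul_comm _ _ _
  have hdc : Continuous (fderiv ℝ φ) := hφ.continuous_fderiv (by simp)
  simp_rw [e1, e2]
  rw [integral_finsetSum, integral_finsetSum]
  · refine Finset.sum_congr rfl fun i _ => ?_
    rw [integral_smul, integral_smul, (hG i).2.2 φ hφ hc]
    simp
  · exact fun i _ => ((hG i).2.1.integrable_smul_left_of_hasCompactSupport
      hφ.continuous hc).smul (h i)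
  · intro i _
    refine Integrable.smul (-h i) ((hG i).1.integrable_smul_left_of_hasCompactSupport
      (hdc.clm_apply continuous_const) ?_)
    exact (hc.fderiv ℝ).mono' (fun z hz => subset_tsupport _ fun h0 => hz (by simp [h0]))

/-- Translation is put on the test function, where t ↦ φ(z - t h) is smooth. Its t-derivative under
the integral is turned into the weak gradient of f, and the mean value inequality on [0, 1]
concludes. -/
theorem norm_integral_translate_sub_le {f : Plane → F} {G : Fin 2 → Plane → F}
    (hG : IsWeakGradient f G) (hG2 : ∀ i, MemLp (G i) 2 volume)
    {φ : Plane → ℝ} (hφ : ContDiff ℝ ∞ φ) (hφ1 : ∀ z, |φ z| ≤ 1)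
    {x h : Plane} {r : ℝ} (hs : Function.support φ ⊆ ball x r) :
    ‖(∫ z, φ (z - h) • f z) - ∫ z, φ z • f z‖
      ≤ ‖h‖ * ∫ z in ball x (r + ‖h‖), √(gradSq G z) := by
  have hc : HasCompactSupport φ := HasCompactSupport.of_support_subset_isCompact
    (isCompact_closedBall x r) (hs.trans ball_subset_closedBall)
  have hf := (hG 0).1
  have hsq : Integrable (fun z => ‖h‖ * √(gradSq G z)) (volume.restrict (ball x (r + ‖h‖))) := by
    have : IsFiniteMeasure ((volume : Measure Plane).restrict (ball x (r + ‖h‖))) :=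
      isFiniteMeasure_restrict.2 measure_ball_lt_top.ne
    exact (((memLp_sqrt_gradSq hG2).restrict _).integrable (by norm_num)).const_mul _
  have key := norm_image_sub_le_of_norm_deriv_le_segment_01'
    (f := fun t : ℝ => ∫ z, φ (z - t • h) • f z)
    (f' := fun t : ℝ => ∫ z, (-(fderiv ℝ φ (z - t • h) h)) • f z)
    (C := ‖h‖ * ∫ z in ball x (r + ‖h‖), √(gradSq G z))
    (fun t _ => (hasDerivAt_integral_translate_smul hf hφ hc h t).hasDerivWithinAt) ?_
  · simpa using key
  intro t ht
  have hφt : ContDiff ℝ ∞ fun z => φ (z - t • h) := hφ.comp (contDiff_id.sub contDiff_const)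
  have hct : HasCompactSupport fun z => φ (z - t • h) :=
    hc.comp_homeomorph (Homeomorph.subRight (t • h))
  have e := hG.integral_fderiv_smul hφt hct h
  simp only [fderiv_comp_sub] at e
  rw [e, ← integral_const_mul, ← integral_indicator measurableSet_ball]
  refine norm_integral_le_of_norm_le ?_ (.of_forall fun z => ?_)
  · rwa [integrable_indicator_iff measurableSet_ball]
  · by_cases hz : z ∈ ball x (r + ‖h‖)
    · rw [Set.indicator_of_mem hz, norm_smul]
      calc ‖φ (z - t • h)‖ * ‖∑ i, h i • G i z‖ ≤ 1 * (‖h‖ * √(gradSq G z)) := by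
            gcongr
            · exact hφ1 _
            · exact norm_sum_smul_le_sqrt_gradSq G h z
        _ = _ := one_mul _
    · have h0 : φ (z - t • h) = 0 := by
        by_contra hne
        have h1 := hs hne
        apply hz
        rw [mem_ball, dist_eq_norm] at h1 ⊢
        calc ‖z - x‖ = ‖(z - t • h - x) + t • h‖ := by congr 1; abel
          _ ≤ ‖z - t • h - x‖ + ‖t • h‖ := norm_add_le _ _
          _ < r + ‖h‖ := by
            rw [norm_smul, Real.norm_eq_abs, abs_of_nonneg ht.1]
            have : t * ‖h‖ ≤ 1 * ‖h‖ := by gcongr; exact ht.2.le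
            linarith
      simp [h0, Set.indicator_of_notMem hz]

end WeakGradient

/-! ### Means over translated balls -/

section BallMeans

variable {F : Type*} [NormedAddCommGroup F]

theorem Plane.volume_real_ball (x : Plane) {r : ℝ} (hr : 0 ≤ r) :
    volume.real (ball x r) = Real.pi * r ^ 2 := by
  rw [Measure.real, EuclideanSpace.volume_ball_fin_two]
  simp [hr, Real.pi_pos.le, mul_comm]

theorem setIntegral_ball_sqrt_gradSq_le {G : Fin 2 → Plane → F}
    (hG : ∀ i, MemLp (G i) 2 volume) (x : Plane) {R : ℝ} (hR : 0 ≤ R) :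
    ∫ z in ball x R, √(gradSq G z) ≤ 2 * R * √(∫ z in ball x R, gradSq G z) := by
  have : IsFiniteMeasure ((volume : Measure Plane).restrict (ball x R)) :=
    isFiniteMeasure_restrict.2 measure_ball_lt_top.ne
  have h := integral_mul_le_Lp_mul_Lq_of_nonneg (μ := volume.restrict (ball x R))
    (f := fun _ => (1 : ℝ)) (g := fun z => √(gradSq G z)) Real.HolderConjugate.two_two
    (.of_forall fun _ => zero_le_one) (.of_forall fun _ => Real.sqrt_nonneg _)
    (memLp_const 1) (by simpa using (memLp_sqrt_gradSq hG).restrict _)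
  simp only [one_mul, one_pow, mul_one, integral_const, smul_eq_mul,
    ← Real.sqrt_eq_rpow, Real.rpow_two, Real.sq_sqrt (gradSq_nonneg G _), measureReal_restrict_apply,
    MeasurableSet.univ, Set.univ_inter, Plane.volume_real_ball x hR] at h
  refine h.trans ?_
  gcongr
  calc √(Real.pi * R ^ 2) ≤ √((2 * R) ^ 2) := by
        apply Real.sqrt_le_sqrt
        nlinarith [Real.pi_le_four, sq_nonneg R]
    _ = 2 * R := Real.sqrt_sq (by positivity)

variable [InnerProductSpace ℝ F]

/-- Bumps supported in the ball, equal to 1 on concentric balls whose radii tend to r, converge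
pointwise to its indicator. This carries the translation estimate from test functions to balls. -/
theorem exists_contDiff_tendsto_setIntegral_ball {f : Plane → F}
    (hf : LocallyIntegrable f volume) (x : Plane) {r : ℝ} (hr : 0 < r) :
    ∃ φ : ℕ → Plane → ℝ, (∀ n, ContDiff ℝ ∞ (φ n)) ∧ (∀ n z, |φ n z| ≤ 1) ∧
      (∀ n, Function.support (φ n) ⊆ ball x r) ∧
      ∀ h, Filter.Tendsto (fun n => ∫ z, φ n (z - h) • f z) Filter.atTop
        (nhds (∫ z in ball (x + h) r, f z)) := by
  have hpos : ∀ n : ℕ, 0 < 1 - 1 / ((n : ℝ) + 2) := fun n => by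
    have : 1 / ((n : ℝ) + 2) < 1 := by
      rw [div_lt_one (by positivity)]
      linarith [n.cast_nonneg (α := ℝ)]
    linarith
  let φ : ℕ → ContDiffBump x := fun n =>
    ⟨r * (1 - 1 / ((n : ℝ) + 2)), r, mul_pos hr (hpos n), by
      have : 0 < 1 / ((n : ℝ) + 2) := by positivity
      nlinarith⟩
  have hle : ∀ n z, |φ n z| ≤ 1 := fun n z => by
    rw [abs_of_nonneg (φ n).nonneg]
    exact (φ n).le_one
  have hsupp : ∀ n, Function.support (φ n) = ball x r := fun n => (φ n).support_eq
  have hlim : ∀ z ∈ ball x r, ∀ᶠ n in Filter.atTop, φ n z = 1 := by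
    intro z hz
    have ht : Filter.Tendsto (fun n : ℕ => r * (1 - 1 / ((n : ℝ) + 2))) Filter.atTop
        (nhds (r * (1 - 0))) := by
      refine (tendsto_const_nhds.sub ?_).const_mul r
      have := tendsto_one_div_add_atTop_nhds_zero_nat (𝕜 := ℝ)
      refine ((Filter.tendsto_add_atTop_iff_nat 1).2 this).congr fun n => ?_
      push_cast
      ring
    rw [sub_zero, mul_one] at ht
    filter_upwards [ht.eventually (lt_mem_nhds (mem_ball.1 hz))] with n hn
    exact (φ n).one_of_mem_closedBall hn.le
  refine ⟨fun n => φ n, fun n => (φ n).contDiff, hle, fun n => (hsupp n).le, fun h => ?_⟩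
  rw [← integral_indicator measurableSet_ball]
  have hmem : ∀ z, z - h ∈ ball x r ↔ z ∈ ball (x + h) r := fun z => by
    rw [mem_ball, mem_ball, dist_eq_norm, dist_eq_norm]
    congr! 2
    abel
  have hzero : ∀ n z, z ∉ ball (x + h) r → φ n (z - h) = 0 := fun n z hz => by
    by_contra hne
    exact hz ((hmem z).1 (by rw [← hsupp n]; exact hne))
  refine tendsto_integral_of_dominated_convergence
    ((ball (x + h) r).indicator fun z => ‖f z‖) (fun n => ?_) ?_ (fun n => .of_forall fun z => ?_)
    (.of_forall fun z => ?_)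
  · exact ((φ n).continuous.comp (by fun_prop : Continuous fun z : Plane => z - h)
      ).aestronglyMeasurable.smul hf.aestronglyMeasurable
  · rw [integrable_indicator_iff measurableSet_ball]
    exact ((hf.integrableOn_isCompact (isCompact_closedBall _ _)).mono_set
      ball_subset_closedBall).norm
  · by_cases hz : z ∈ ball (x + h) r
    · rw [Set.indicator_of_mem hz, norm_smul]
      exact mul_le_of_le_one_left (norm_nonneg _) (hle _ _)
    · simp [Set.indicator_of_notMem hz, hzero n z hz]
  · by_cases hz : z ∈ ball (x + h) r
    · rw [Set.indicator_of_mem hz]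
      refine Filter.Tendsto.congr' ?_ tendsto_const_nhds
      filter_upwards [hlim _ ((hmem z).2 hz)] with n hn
      simp [hn]
    · rw [Set.indicator_of_notMem hz]
      exact tendsto_const_nhds.congr fun n => by simp [hzero n z hz]

theorem norm_setIntegral_ball_add_sub_le {f : Plane → F} {G : Fin 2 → Plane → F}
    (hG : IsWeakGradient f G) (hG2 : ∀ i, MemLp (G i) 2 volume) (x h : Plane) {r : ℝ}
    (hr : 0 < r) :
    ‖(∫ z in ball (x + h) r, f z) - ∫ z in ball x r, f z‖
      ≤ ‖h‖ * ∫ z in ball x (r + ‖h‖), √(gradSq G z) := by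
  obtain ⟨φ, hφ, hφ1, hs, ht⟩ := exists_contDiff_tendsto_setIntegral_ball (hG 0).1 x hr
  have h0 := ht 0
  simp only [sub_zero, add_zero] at h0
  exact le_of_tendsto ((ht h).sub h0).norm
    (.of_forall fun n => norm_integral_translate_sub_le hG hG2 (hφ n) (hφ1 n) (hs n))

theorem norm_setAverage_ball_add_sub_le {f : Plane → F} {G : Fin 2 → Plane → F}
    (hG : IsWeakGradient f G) (hG2 : ∀ i, MemLp (G i) 2 volume) (x h : Plane) {r R : ℝ}
    (hr : 0 < r) (hR : r + ‖h‖ ≤ R) :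
    ‖(⨍ z in ball (x + h) r, f z) - ⨍ z in ball x r, f z‖
      ≤ ‖h‖ * R / r ^ 2 * √(∫ z in ball x R, gradSq G z) := by
  have hR0 : 0 ≤ R := (add_pos_of_pos_of_nonneg hr (norm_nonneg h)).le.trans hR
  rw [setAverage_eq, setAverage_eq, Plane.volume_real_ball _ hr.le, Plane.volume_real_ball _ hr.le,
    ← smul_sub, norm_smul, norm_inv, Real.norm_of_nonneg (by positivity)]
  have hm : ∫ z in ball x (r + ‖h‖), √(gradSq G z) ≤ ∫ z in ball x R, √(gradSq G z) := by
    refine setIntegral_mono_set ?_ (.of_forall fun _ => Real.sqrt_nonneg _)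
      (ball_subset_ball hR).eventuallyLE
    exact ((memLp_sqrt_gradSq hG2).locallyIntegrable (by norm_num)).integrableOn_isCompact
      (isCompact_closedBall x R) |>.mono_set ball_subset_closedBall
  have h1 := norm_setIntegral_ball_add_sub_le hG hG2 x h hr
  have h2 := setIntegral_ball_sqrt_gradSq_le hG2 x hR0
  set S := √(∫ z in ball x R, gradSq G z) with hS
  calc _ ≤ (Real.pi * r ^ 2)⁻¹ * (‖h‖ * (2 * R * S)) := by
        gcongr
        exact h1.trans (by gcongr; exact hm.trans h2)
    _ ≤ (2 * r ^ 2)⁻¹ * (‖h‖ * (2 * R * S)) := by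
        gcongr
        exact Real.two_le_pi
    _ = _ := by field_simp

end BallMeans

/-! ### Comparing means at two scales by double averaging -/

section DoubleAverage

variable {F : Type*} [NormedAddCommGroup F] [InnerProductSpace ℝ F]

theorem setIntegral_ball_zero_add (f : Plane → F) (c : Plane) (r : ℝ) :
    ∫ z in ball 0 r, f (c + z) = ∫ z in ball c r, f z := by
  rw [← integral_indicator measurableSet_ball, ← integral_indicator measurableSet_ball,
    ← integral_add_left_eq_self ((ball c r).indicator f) c]
  refine integral_congr_ae (.of_forall fun z => ?_)
  classical simp [Set.indicator_apply, dist_eq_norm]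

theorem setIntegral_ball_zero_sub (f : Plane → F) (c : Plane) (r : ℝ) :
    ∫ z in ball 0 r, f (c - z) = ∫ z in ball c r, f z := by
  rw [← integral_indicator measurableSet_ball, ← integral_indicator measurableSet_ball,
    ← integral_sub_left_eq_self ((ball c r).indicator f) volume c]
  refine integral_congr_ae (.of_forall fun z => ?_)
  classical simp [Set.indicator_apply, dist_eq_norm]

/-- On the product of the balls the integrand coincides with that of a convolution of two integrable
functions, the indicator of a ball and f cut off to a larger ball. -/
theorem integrable_prod_ball_translate {f : Plane → F} (hf : LocallyIntegrable f volume)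
    (x : Plane) (s r : ℝ) :
    Integrable (Function.uncurry fun z y => f (x + z - y))
      ((volume.restrict (ball 0 s)).prod (volume.restrict (ball 0 r))) := by
  have h1 : Integrable ((ball (0 : Plane) r).indicator fun _ => (1 : ℝ)) volume := by
    rw [integrable_indicator_iff measurableSet_ball]
    exact integrableOn_const measure_ball_lt_top.ne
  have h2 : Integrable (fun w => (ball x (s + r)).indicator f (x + w)) volume := by
    refine Integrable.comp_add_left (g := x) ?_
    rw [integrable_indicator_iff measurableSet_ball]
    exact (hf.integrableOn_isCompact (isCompact_closedBall _ _)).mono_set ball_subset_closedBall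
  have h3 := (h1.convolution_integrand (ContinuousLinearMap.lsmul ℝ ℝ) h2).integrableOn
    (s := ball (0 : Plane) s ×ˢ ball (0 : Plane) r)
  rw [Measure.prod_restrict]
  refine h3.congr_fun (fun p hp => ?_) (measurableSet_ball.prod measurableSet_ball)
  obtain ⟨hz, hy⟩ := hp
  have hm : x + (p.1 - p.2) ∈ ball x (s + r) := by
    rw [mem_ball_zero_iff] at hz hy
    rw [mem_ball, dist_eq_norm, add_sub_cancel_left]
    exact (norm_sub_le _ _).trans_lt (add_lt_add hz hy)
  simp [Set.indicator_of_mem hy, Set.indicator_of_mem hm, Function.uncurry, add_sub_assoc]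

/-- Fubini: both sides average f(x + z - y) over z in B_s and y in B_r. -/
theorem setAverage_ball_comm {f : Plane → F} (hf : LocallyIntegrable f volume)
    (x : Plane) (s r : ℝ) :
    ⨍ z in ball (0 : Plane) s, ⨍ w in ball (x + z) r, f w
      = ⨍ y in ball (0 : Plane) r, ⨍ w in ball (x - y) s, f w := by
  have h := integral_integral_swap (integrable_prod_ball_translate hf x s r)
  simp only [setAverage_eq, Measure.addHaar_real_ball_center]
  rw [integral_smul, integral_smul, smul_comm]
  congr 2
  convert h using 2
  · ext z
    exact (setIntegral_ball_zero_sub f _ _).symm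
  · ext y
    rw [← setIntegral_ball_zero_add f (x - y)]
    congr 1 with z
    congr 1
    abel

theorem norm_setAverage_ball_sub_le_of_forall [CompleteSpace F] {u : Plane → F} {s : ℝ}
    (hs : 0 < s) (hu : IntegrableOn u (ball 0 s)) {c : F} {C : ℝ}
    (h : ∀ z ∈ ball (0 : Plane) s, ‖u z - c‖ ≤ C) : ‖(⨍ z in ball (0 : Plane) s, u z) - c‖ ≤ C := by
  rw [← dist_eq_norm, ← mem_closedBall]
  refine (convex_closedBall c C).set_average_mem isClosed_closedBall
    (measure_ball_pos _ _ hs).ne' measure_ball_lt_top.ne ?_ hu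
  refine (ae_restrict_mem measurableSet_ball).mono fun z hz => ?_
  rw [mem_closedBall, dist_eq_norm]
  exact h z hz

/-- Takes the place of a Poincaré inequality. The double average over B_{r/2} and B_r is both an
average of means over translates of B_r(x) and one of means over translates of B_{r/2}(x), so the
translation estimate puts it close to both means. -/
theorem norm_setAverage_ball_half_sub_le [CompleteSpace F] {f : Plane → F}
    {G : Fin 2 → Plane → F} (hG : IsWeakGradient f G) (hG2 : ∀ i, MemLp (G i) 2 volume)
    (x : Plane) {r : ℝ} (hr : 0 < r) :
    ‖(⨍ z in ball x (r / 2), f z) - ⨍ z in ball x r, f z‖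
      ≤ 9 * √(∫ z in ball x (2 * r), gradSq G z) := by
  have hf := (hG 0).1
  set S := √(∫ z in ball x (2 * r), gradSq G z)
  have hi := integrable_prod_ball_translate hf x (r / 2) r
  have i1 : IntegrableOn (fun z => ⨍ w in ball (x + z) r, f w) (ball 0 (r / 2)) := by
    simp only [setAverage_eq, Measure.addHaar_real_ball_center]
    refine (hi.integral_prod_left.congr (.of_forall fun z => ?_)).smul _
    exact setIntegral_ball_zero_sub f (x + z) r
  have i2 : IntegrableOn (fun y => ⨍ w in ball (x - y) (r / 2), f w) (ball 0 r) := by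
    simp only [setAverage_eq, Measure.addHaar_real_ball_center]
    refine (hi.integral_prod_right.congr (.of_forall fun y => ?_)).smul _
    rw [← setIntegral_ball_zero_add f (x - y)]
    refine integral_congr_ae (.of_forall fun z => ?_)
    simp only [Function.uncurry]
    congr 1
    abel
  have b1 : ‖(⨍ z in ball (0 : Plane) (r / 2), ⨍ w in ball (x + z) r, f w)
      - ⨍ z in ball x r, f z‖ ≤ 1 * S := by
    refine norm_setAverage_ball_sub_le_of_forall (by positivity) i1 fun z hz => ?_
    rw [mem_ball_zero_iff] at hz
    refine (norm_setAverage_ball_add_sub_le hG hG2 x z hr (R := 2 * r) (by linarith)).trans ?_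
    gcongr
    rw [div_le_one (by positivity)]
    nlinarith
  have b2 : ‖(⨍ y in ball (0 : Plane) r, ⨍ w in ball (x - y) (r / 2), f w)
      - ⨍ z in ball x (r / 2), f z‖ ≤ 8 * S := by
    refine norm_setAverage_ball_sub_le_of_forall hr i2 fun y hy => ?_
    rw [mem_ball_zero_iff] at hy
    rw [sub_eq_add_neg x y]
    refine (norm_setAverage_ball_add_sub_le hG hG2 x (-y) (r := r / 2) (R := 2 * r)
      (by positivity) (by rw [norm_neg]; linarith)).trans ?_
    gcongr
    rw [norm_neg, div_le_iff₀ (by positivity)]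
    nlinarith
  rw [setAverage_ball_comm hf] at b1
  calc _ ≤ _ := norm_sub_le_norm_sub_add_norm_sub _
        (⨍ y in ball (0 : Plane) r, ⨍ w in ball (x - y) (r / 2), f w) _
    _ ≤ 8 * S + 1 * S := by
      rw [norm_sub_rev]
      exact add_le_add b2 b1
    _ = 9 * S := by ring

theorem norm_setAverage_ball_sub_setAverage_ball_le {f : Plane → F}
    {G : Fin 2 → Plane → F} (hG : IsWeakGradient f G) (hG2 : ∀ i, MemLp (G i) 2 volume)
    {x y : Plane} {r : ℝ} (hr : 0 < r) (hxy : dist x y ≤ r) :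
    ‖(⨍ z in ball x r, f z) - ⨍ z in ball y r, f z‖
      ≤ 2 * √(∫ z in ball y (2 * r), gradSq G z) := by
  rw [dist_eq_norm] at hxy
  have h := norm_setAverage_ball_add_sub_le hG hG2 y (x - y) hr (R := 2 * r) (by linarith)
  rw [add_sub_cancel] at h
  refine h.trans ?_
  gcongr
  rw [div_le_iff₀ (by positivity)]
  nlinarith

end DoubleAverage

/-! ### Hole-filling recursions for real sequences -/

section HoleFilling

/-- Polynomial decay in the hole-filling recursion with linearly growing coefficients. -/
theorem exists_polynomial_decay {c q A : ℝ} (hc : 0 ≤ c) (hq0 : 0 ≤ q) (hq1 : q < 1)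
    (hA : 1 ≤ A) (d₁ : ℝ) :
    ∃ M k₀ : ℝ, 0 ≤ M ∧ 2 ≤ k₀ ∧ ∀ d N : ℕ → ℝ, (∀ k, 0 ≤ d k) → d 0 ≤ d₁ →
      (∀ k, 1 ≤ N k) → (∀ k, N k ≤ A + k / 5) →
      (∀ k, N k * d (k + 1) ≤ (N k - 1) * d k + c * q ^ k) →
      ∀ k, d k ≤ M / (k + k₀) ^ 4 := by
  have hk₀ : 1 ≤ 5 * A := by linarith
  obtain ⟨B, hB⟩ : ∃ B, ∀ k : ℕ, (k + 5 * A) ^ 4 * q ^ k ≤ B := by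
    obtain ⟨B, hB⟩ := (tendsto_pow_const_mul_const_pow_of_lt_one 4 hq0 hq1).bddAbove_range
    refine ⟨8 * (B + (5 * A) ^ 4), fun k => ?_⟩
    have h1 : (k : ℝ) ^ 4 * q ^ k ≤ B := hB ⟨k, rfl⟩
    have h2 : ((k : ℝ) + 5 * A) ^ 4 ≤ 8 * ((k : ℝ) ^ 4 + (5 * A) ^ 4) := by
      have := add_pow_le k.cast_nonneg (by linarith : (0 : ℝ) ≤ 5 * A) 4
      norm_num at this ⊢
      linarith
    have h3 : q ^ k ≤ 1 := pow_le_one₀ hq0 hq1.le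
    have h4 : 0 ≤ q ^ k := pow_nonneg hq0 k
    have h5 : 0 ≤ (5 * A) ^ 4 := by positivity
    nlinarith [mul_le_mul_of_nonneg_right h2 h4, mul_le_mul_of_nonneg_left h3 h5]
  -- With shift 5A the growth bound reads N k ≤ j / 5 for j = k + 5A. The two entries of the maximum
  -- start the induction and keep the source below a fifth of M / j⁴.
  refine ⟨max 0 (max (d₁ * (5 * A) ^ 4) (5 * (c * B))), 5 * A, le_max_left _ _, by linarith, ?_⟩
  intro d N hd hd0 hN1 hN hrec
  set M := max 0 (max (d₁ * (5 * A) ^ 4) (5 * (c * B)))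
  have hM0 : 0 ≤ M := le_max_left _ _
  have hM1 : d₁ * (5 * A) ^ 4 ≤ M := (le_max_left _ _).trans (le_max_right _ _)
  have hM2 : 5 * (c * B) ≤ M := (le_max_right _ _).trans (le_max_right _ _)
  intro k
  induction k with
  | zero =>
    rw [Nat.cast_zero, zero_add, le_div_iff₀ (by positivity)]
    exact (by gcongr : d 0 * (5 * A) ^ 4 ≤ d₁ * (5 * A) ^ 4).trans hM1
  | succ k ih =>
    have h1 := hrec k
    have hNk := hN1 k
    have hNk' := hN k
    set j : ℝ := k + 5 * A with hj
    have hj5 : 5 ≤ j := by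
      have : (0 : ℝ) ≤ k := k.cast_nonneg
      linarith
    have hj0 : 0 < j := by linarith
    have hcast : ((k + 1 : ℕ) : ℝ) + 5 * A = j + 1 := by
      push_cast
      ring
    rw [hcast]
    have hNj : N k ≤ j / 5 := by
      rw [hj]
      linarith
    have hsource : c * q ^ k ≤ M / j ^ 4 / 5 := by
      rw [le_div_iff₀ (by norm_num), le_div_iff₀ (by positivity)]
      have := mul_le_mul_of_nonneg_left (hB k) hc
      linarith
    -- Bernoulli: (j / (j + 1))⁴ ≥ 1 - 4 / j.
    have hshift : M / j ^ 4 * (1 - 4 / j) ≤ M / (j + 1) ^ 4 := by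
      rw [div_mul_eq_mul_div, div_le_div_iff₀ (by positivity) (by positivity), mul_assoc]
      gcongr
      have : (1 - 4 / j) * (j + 1) ^ 4 = ((j - 4) * (j + 1) ^ 4) / j := by field_simp
      rw [this, div_le_iff₀ hj0]
      nlinarith [pow_pos hj0 2, pow_pos hj0 3]
    have hP : 0 ≤ M / j ^ 4 := by positivity
    -- In units of M / j⁴, the right side of the recursion is at most N - 1 + 1/5 = N - 4/5, while
    -- the target is at least N - 4N/j ≥ N - 4/5. Slope 1/5 is exactly what exponent 4 and a source
    -- share of 1/5 allow.
    have hstep : N k * d (k + 1) ≤ N k * (M / (j + 1) ^ 4) := by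
      have e1 : (N k - 1) * d k ≤ (N k - 1) * (M / j ^ 4) :=
        mul_le_mul_of_nonneg_left ih (by linarith)
      have e2 : N k * (M / j ^ 4 * (1 - 4 / j)) ≤ N k * (M / (j + 1) ^ 4) := by gcongr
      have e3 : N k * (4 / j) ≤ 4 / 5 := by
        rw [mul_div_assoc', div_le_iff₀ hj0]
        linarith
      have e4 : N k * (M / j ^ 4 * (1 - 4 / j)) = M / j ^ 4 * (N k - N k * (4 / j)) := by ring
      have e5 : M / j ^ 4 * (N k - 4 / 5) ≤ M / j ^ 4 * (N k - N k * (4 / j)) := by gcongr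
      linarith
    exact le_of_mul_le_mul_left hstep (by linarith)

/-- Geometric decay in the hole-filling recursion with bounded coefficients. -/
theorem exists_geometric_decay {c q N₀ : ℝ} (hc : 0 ≤ c) (hq0 : 0 ≤ q) (hq1 : q < 1)
    (hN₀ : 1 ≤ N₀) (d₁ : ℝ) :
    ∃ C θ : ℝ, 0 ≤ C ∧ 1 / 4 ≤ θ ∧ θ < 1 ∧ ∀ d N : ℕ → ℝ, (∀ k, 0 ≤ d k) → d 0 ≤ d₁ →
      (∀ k, 1 ≤ N k) → (∀ k, N k ≤ N₀) →
      (∀ k, N k * d (k + 1) ≤ (N k - 1) * d k + c * q ^ k) →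
      ∀ k, d k ≤ C * θ ^ k := by
  have hN0 : 0 < N₀ := by linarith
  have hinv : 1 / (2 * N₀) ≤ 1 / 2 := by
    apply one_div_le_one_div_of_le <;> linarith
  have hinv0 : 0 < 1 / (2 * N₀) := by positivity
  -- Only half of the gain 1 / N₀ goes into the rate; the other half absorbs the source, since c ≤ C
  -- / 2.
  refine ⟨max d₁ (2 * N₀ * c), max q (1 - 1 / (2 * N₀)), ?_, ?_, ?_, ?_⟩
  · exact le_max_of_le_right (by positivity)
  · exact le_max_of_le_right (by linarith)
  · exact max_lt hq1 (by linarith)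
  intro d N hd hd0 hN1 hN hrec
  set C := max d₁ (2 * N₀ * c)
  set θ := max q (1 - 1 / (2 * N₀))
  have hC : 2 * N₀ * c ≤ C := le_max_right _ _
  have hθ : 1 - 1 / (2 * N₀) ≤ θ := le_max_right _ _
  have hθ0 : 0 ≤ θ := hq0.trans (le_max_left _ _)
  have hC0 : 0 ≤ C := le_trans (by positivity) hC
  intro k
  induction k with
  | zero => simpa only [pow_zero, mul_one] using hd0.trans (le_max_left _ _)
  | succ k ih =>
    have h1 := hrec k
    have hNk := hN1 k
    have hqθ : c * q ^ k ≤ c * θ ^ k := by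
      gcongr
      exact le_max_left _ _
    have hstep : N k * d (k + 1) ≤ N k * (C * θ ^ (k + 1)) := by
      have e1 : (N k - 1) * d k ≤ (N k - 1) * (C * θ ^ k) :=
        mul_le_mul_of_nonneg_left ih (by linarith)
      have e2 : N k * (1 - 1 / (2 * N₀)) ≤ N k * θ := by gcongr
      have e3 : N k / (2 * N₀) ≤ 1 / 2 := by
        rw [div_le_iff₀ (by positivity)]
        linarith [hN k]
      have e4 : N k - 1 / 2 ≤ N k * θ := by
        have : N k * (1 - 1 / (2 * N₀)) = N k - N k / (2 * N₀) := by ring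
        linarith
      have e5 : c ≤ C / 2 := by nlinarith
      have hp : 0 ≤ θ ^ k := by positivity
      calc N k * d (k + 1) ≤ (N k - 1) * (C * θ ^ k) + c * θ ^ k := by linarith
        _ = ((N k - 1) * C + c) * θ ^ k := by ring
        _ ≤ (N k * θ * C) * θ ^ k := by
          gcongr
          nlinarith
        _ = _ := by ring
    exact le_of_mul_le_mul_left hstep (by linarith)

/-- Telescoping, from 1 / t² ≤ 1 / (t - 1) - 1 / t. -/
theorem sum_inv_add_sq_le {k₀ : ℝ} (hk₀ : 2 ≤ k₀) (n : ℕ) :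
    ∑ k ∈ Finset.range n, 1 / ((k : ℝ) + k₀) ^ 2 ≤ 1 - 1 / (n + k₀ - 1) := by
  induction n with
  | zero =>
    have : 1 / (k₀ - 1) ≤ 1 := by
      rw [div_le_one (by linarith)]
      linarith
    simpa using this
  | succ n ih =>
    rw [Finset.sum_range_succ]
    have hn : (0 : ℝ) ≤ n := n.cast_nonneg
    have h1 : 0 < (n : ℝ) + k₀ - 1 := by linarith
    have h2 : 0 < (n : ℝ) + k₀ := by linarith
    have h3 : 1 / ((n : ℝ) + k₀) ^ 2 ≤ 1 / (n + k₀ - 1) - 1 / (n + k₀) := by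
      rw [div_sub_div _ _ h1.ne' h2.ne', div_le_div_iff₀ (by positivity) (by positivity)]
      nlinarith
    have h4 : ((n + 1 : ℕ) : ℝ) + k₀ - 1 = n + k₀ := by
      push_cast
      ring
    rw [h4]
    linarith

/-- If the hole-filling coefficients grow at most by `δ √d` in each step and `d` is small, then
`d` decays geometrically. -/
theorem exists_geometric_decay_of_hole_filling {c q b M₀ ε c₀ : ℝ} (hc : 0 ≤ c) (hq0 : 0 ≤ q)
    (hq1 : q < 1) (hb : 0 ≤ b) (hM₀ : 0 ≤ M₀) (hc₀ : 0 ≤ c₀)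
    (hsmall : c₀ * (b * √ε) ≤ 1 / 5) :
    ∃ C θ : ℝ, 0 ≤ C ∧ 1 / 4 ≤ θ ∧ θ < 1 ∧ ∀ d m : ℕ → ℝ, (∀ k, 0 ≤ d k) → (∀ k, d k ≤ ε) →
      (∀ k, 0 ≤ m k) → m 0 ≤ M₀ → m 1 ≤ M₀ → (∀ k, m (k + 2) ≤ m (k + 1) + b * √(d k)) →
      (∀ k, d (k + 1) ≤ c₀ * (1 + m k) * (d k - d (k + 1)) + c * q ^ k) →
      ∀ k, d k ≤ C * θ ^ k := by
  obtain ⟨M, k₀, hM, hk₀, hpoly⟩ := exists_polynomial_decay hc hq0 hq1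
    (A := 1 + c₀ * (1 + M₀)) (by nlinarith) ε
  -- The first pass gives √(d i) ≤ √M / (i + k₀)², and these inverse squares sum to at most 1, so
  -- the means never exceed M₀ + b√M.
  obtain ⟨C, θ, hC, hθ, hθ1, hgeo⟩ := exists_geometric_decay hc hq0 hq1
    (N₀ := 1 + c₀ * (1 + (M₀ + b * √M))) (by
      have : 0 ≤ c₀ * (1 + (M₀ + b * √M)) := by positivity
      linarith) ε
  refine ⟨C, θ, hC, hθ, hθ1, fun d m hd hdε hm hm0 hm1 hmstep hrec => ?_⟩
  have hrec' : ∀ k, (1 + c₀ * (1 + m k)) * d (k + 1)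
      ≤ (1 + c₀ * (1 + m k) - 1) * d k + c * q ^ k := fun k => by linarith [hrec k]
  have hN1 : ∀ k, 1 ≤ 1 + c₀ * (1 + m k) := fun k => by
    have := mul_nonneg hc₀ (by linarith [hm k] : 0 ≤ 1 + m k)
    linarith
  have hsum : ∀ k, m (k + 1) ≤ M₀ + ∑ i ∈ Finset.range k, b * √(d i) := by
    intro k
    induction k with
    | zero => simpa using hm1
    | succ k ih =>
      rw [Finset.sum_range_succ]
      linarith [hmstep k]
  have hlin : ∀ k, 1 + c₀ * (1 + m k) ≤ 1 + c₀ * (1 + M₀) + k / 5 := by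
    have hlin' : ∀ k : ℕ, c₀ * m k ≤ c₀ * M₀ + k / 5 := by
      rintro (_ | k)
      · simpa using mul_le_mul_of_nonneg_left hm0 hc₀
      · have h1 : ∑ i ∈ Finset.range k, b * √(d i) ≤ k * (b * √ε) := by
          refine (Finset.sum_le_card_nsmul _ _ (b * √ε) fun i _ => ?_).trans_eq (by simp)
          gcongr
          exact hdε i
        have h2 := mul_le_mul_of_nonneg_left ((hsum k).trans (add_le_add_right h1 M₀)) hc₀
        have h3 := mul_le_mul_of_nonneg_left hsmall (k.cast_nonneg (α := ℝ))
        push_cast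
        nlinarith
    intro k
    nlinarith [hlin' k]
  have hdec := hpoly d _ hd (hdε 0) hN1 hlin hrec'
  have hbdd : ∀ k, m k ≤ M₀ + b * √M := by
    have hbM : 0 ≤ b * √M := by positivity
    rintro (_ | k)
    · linarith
    · refine (hsum k).trans (add_le_add_right ?_ M₀)
      have h1 : ∀ i ∈ Finset.range k, b * √(d i) ≤ b * √M * (1 / ((i : ℝ) + k₀) ^ 2) := by
        intro i _
        have : √(d i) ≤ √M * (1 / ((i : ℝ) + k₀) ^ 2) := by
          refine (Real.sqrt_le_sqrt (hdec i)).trans_eq ?_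
          rw [Real.sqrt_div hM, show ((i : ℝ) + k₀) ^ 4 = (((i : ℝ) + k₀) ^ 2) ^ 2 by ring,
            Real.sqrt_sq (by positivity), div_eq_mul_one_div]
        rw [mul_assoc]
        gcongr
      refine (Finset.sum_le_sum h1).trans ?_
      rw [← Finset.mul_sum]
      refine mul_le_of_le_one_right hbM ((sum_inv_add_sq_le hk₀ k).trans ?_)
      have : 0 ≤ 1 / ((k : ℝ) + k₀ - 1) := by
        have : (0 : ℝ) ≤ k := k.cast_nonneg
        exact div_nonneg zero_le_one (by linarith)
      linarith
  refine hgeo d _ hd (hdε 0) hN1 (fun k => ?_) hrec'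
  gcongr
  exact hbdd k

end HoleFilling

/-! ### Morrey's lemma and uniformity in the centre -/

section Morrey

variable {F : Type*} [NormedAddCommGroup F]

theorem HolderOnWith.of_dist_le {X : Type*} [PseudoMetricSpace X] {g : X → F} {K : Set X}
    {C α : ℝ} (hα : 0 ≤ α)
    (h : ∀ x ∈ K, ∀ y ∈ K, dist (g x) (g y) ≤ C * dist x y ^ α) :
    HolderOnWith C.toNNReal α.toNNReal g K := by
  intro x hx y hy
  rw [edist_dist, edist_dist, Real.coe_toNNReal _ hα, ENNReal.ofReal_rpow_of_nonneg dist_nonneg hα]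
  change _ ≤ ENNReal.ofReal C * _
  rw [← ENNReal.ofReal_mul' (by positivity)]
  exact ENNReal.ofReal_le_ofReal (h x hx y hy)

/-- Absolute continuity of the integral; it is uniform in the centre because the area of a ball
depends only on its radius. -/
theorem exists_forall_setIntegral_ball_le {u : Plane → ℝ} (hu : Integrable u volume) {ε ρ : ℝ}
    (hε : 0 < ε) (hρ : 0 < ρ) :
    ∃ r, 0 < r ∧ r < ρ ∧ ∀ x, ∫ z in ball x r, u z ≤ ε := by
  have ht : Filter.Tendsto (volume ∘ fun p : Plane × ℝ => ball p.1 p.2)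
      (Filter.comap Prod.snd (nhdsWithin 0 (Set.Ioi 0))) (nhds 0) := by
    have h1 : Filter.Tendsto (fun r : ℝ => ENNReal.ofReal r ^ 2 * ENNReal.ofReal Real.pi)
        (nhds 0) (nhds (ENNReal.ofReal 0 ^ 2 * ENNReal.ofReal Real.pi)) :=
      ENNReal.Tendsto.mul_const (((ENNReal.continuous_pow 2).comp ENNReal.continuous_ofReal).tendsto 0)
        (Or.inr ENNReal.ofReal_ne_top)
    simp only [ENNReal.ofReal_zero, ne_eq, OfNat.ofNat_ne_zero, not_false_eq_true, zero_pow,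
      zero_mul] at h1
    refine ((h1.mono_left nhdsWithin_le_nhds).comp Filter.tendsto_comap).congr fun p => ?_
    simp [EuclideanSpace.volume_ball_fin_two]
  have h2 := (hu.tendsto_setIntegral_nhds_zero ht).eventually (gt_mem_nhds hε)
  rw [Filter.eventually_comap] at h2
  obtain ⟨r, hr, hr'⟩ := (h2.and (Ioo_mem_nhdsGT hρ)).exists
  exact ⟨r, hr'.1, hr'.2, fun x => (hr (x, r) rfl).le⟩

theorem exists_norm_setAverage_ball_le [NormedSpace ℝ F] {f : Plane → F}
    (hf : LocallyIntegrable f volume) (R : ℝ) (s : ℝ) :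
    ∃ M, ∀ x ∈ closedBall (0 : Plane) R, ‖⨍ z in ball x s, f z‖ ≤ M := by
  refine ⟨(volume.real (ball (0 : Plane) s))⁻¹ * ∫ z in closedBall (0 : Plane) (R + s), ‖f z‖,
    fun x hx => ?_⟩
  rw [setAverage_eq, Measure.addHaar_real_ball_center, norm_smul, norm_inv,
    Real.norm_of_nonneg measureReal_nonneg]
  gcongr
  refine (norm_integral_le_integral_norm _).trans ?_
  suffices hsub : ball x s ⊆ closedBall 0 (R + s) from
    setIntegral_mono_set (hf.integrableOn_isCompact (isCompact_closedBall _ _)).norm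
      (.of_forall fun _ => norm_nonneg _) hsub.eventuallyLE
  intro z hz
  rw [mem_closedBall_zero_iff] at hx ⊢
  rw [mem_ball, dist_eq_norm] at hz
  calc ‖z‖ = ‖x + (z - x)‖ := by rw [add_sub_cancel]
    _ ≤ ‖x‖ + ‖z - x‖ := norm_add_le _ _
    _ ≤ R + s := by linarith

theorem ae_tendsto_setAverage_ball [NormedSpace ℝ F] [CompleteSpace F] {f : Plane → F}
    (hf : LocallyIntegrable f volume) {δ : ℕ → ℝ}
    (hδ : Filter.Tendsto δ Filter.atTop (nhdsWithin 0 (Set.Ioi 0))) :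
    ∀ᵐ x, Filter.Tendsto (fun k => ⨍ z in ball x (δ k), f z) Filter.atTop (nhds (f x)) := by
  filter_upwards [IsUnifLocDoublingMeasure.ae_tendsto_average volume hf 1] with x hx
  have hδ0 : ∀ᶠ k in Filter.atTop, 0 < δ k :=
    hδ.eventually self_mem_nhdsWithin
  refine (hx (fun _ => x) δ hδ ?_).congr fun k => ?_
  · filter_upwards [hδ0] with k hk
    simpa using hk.le
  · refine setAverage_congr ?_
    rw [← ball_union_sphere]
    exact union_ae_eq_left_of_ae_eq_empty (ae_eq_empty.2 (Measure.addHaar_sphere volume x (δ k)))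

/-- Morrey's lemma: if the Dirichlet integral over dyadic balls decays geometrically, locally
uniformly in the centre, then the function is locally Hölder continuous. -/
theorem exists_isLocallyHolder_of_gradSq_decay [InnerProductSpace ℝ F] [CompleteSpace F]
    {f : Plane → F} {G : Fin 2 → Plane → F}
    (hG : IsWeakGradient f G) (hG2 : ∀ i, MemLp (G i) 2 volume) {r₀ : ℝ} (hr₀ : 0 < r₀)
    (H : ∀ R : ℝ, ∃ C θ : ℝ, 0 ≤ C ∧ 1 / 4 ≤ θ ∧ θ < 1 ∧ ∀ x ∈ closedBall (0 : Plane) R, ∀ k : ℕ,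
      ∫ z in ball x (r₀ * (1 / 2) ^ k), gradSq G z ≤ C * θ ^ k) :
    ∃ g : Plane → F, f =ᵐ[volume] g ∧ IsLocallyHolder g := by
  have hf := (hG 0).1
  set u : ℕ → Plane → F := fun k x => ⨍ z in ball x (r₀ * (1 / 2) ^ k), f z with hu
  have hr : ∀ k : ℕ, 0 < r₀ * (1 / 2) ^ k := fun k => by positivity
  have hstep : ∀ {C θ : ℝ} {x : Plane}, 0 ≤ C → 0 ≤ θ →
      (∀ k : ℕ, ∫ z in ball x (r₀ * (1 / 2) ^ k), gradSq G z ≤ C * θ ^ k) →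
      ∀ k, √(∫ z in ball x (r₀ * (1 / 2) ^ k), gradSq G z) ≤ √C * √θ ^ k := by
    intro C θ x hC hθ h k
    refine (Real.sqrt_le_sqrt (h k)).trans_eq ?_
    rw [Real.sqrt_mul hC]
    congr 1
    rw [Real.sqrt_eq_iff_mul_self_eq (by positivity) (by positivity), ← mul_pow,
      Real.mul_self_sqrt hθ]
  -- The sequence of means starts at index 1 because comparing the means on B_r and B_{r/2} costs
  -- the Dirichlet integral over B_{2r}.
  have hdist : ∀ {C θ : ℝ} {x : Plane}, 0 ≤ C → 0 ≤ θ →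
      (∀ k : ℕ, ∫ z in ball x (r₀ * (1 / 2) ^ k), gradSq G z ≤ C * θ ^ k) →
      ∀ k, dist (u (k + 1) x) (u (k + 1 + 1) x) ≤ 9 * √C * √θ ^ k := by
    intro C θ x hC hθ h k
    have h1 := norm_setAverage_ball_half_sub_le hG hG2 x (hr (k + 1))
    rw [show r₀ * (1 / 2) ^ (k + 1) / 2 = r₀ * (1 / 2) ^ (k + 1 + 1) by ring,
      show 2 * (r₀ * (1 / 2) ^ (k + 1)) = r₀ * (1 / 2) ^ k by ring] at h1
    rw [dist_comm, dist_eq_norm, mul_assoc]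
    refine h1.trans ?_
    gcongr
    exact hstep hC hθ h k
  have hsqrt1 : ∀ {θ : ℝ}, θ < 1 → √θ < 1 := fun h => by
    rw [Real.sqrt_lt' one_pos]
    simpa using h
  have hlim : ∀ x, ∃ y, Filter.Tendsto (fun k => u (k + 1) x) Filter.atTop (nhds y) := by
    intro x
    obtain ⟨C, θ, hC, hθ, hθ1, h⟩ := H ‖x‖
    exact cauchySeq_tendsto_of_complete (cauchySeq_of_le_geometric _ _ (hsqrt1 hθ1)
      (hdist hC (by linarith) (h x (by simp))))
  choose g hg using hlim
  refine ⟨g, ?_, fun K hK => ?_⟩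
  · have hδ : Filter.Tendsto (fun k : ℕ => r₀ * (1 / 2) ^ k) Filter.atTop
        (nhdsWithin 0 (Set.Ioi 0)) := by
      refine tendsto_nhdsWithin_iff.2 ⟨?_, .of_forall hr⟩
      simpa using (tendsto_pow_atTop_nhds_zero_of_lt_one (r := (1 / 2 : ℝ)) (by norm_num)
        (by norm_num)).const_mul r₀
    filter_upwards [ae_tendsto_setAverage_ball hf hδ] with x hx
    exact tendsto_nhds_unique ((Filter.tendsto_add_atTop_iff_nat 1).2 hx) (hg x)
  obtain ⟨R, hR⟩ := hK.isBounded.subset_closedBall 0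
  obtain ⟨C, θ, hC, hθ, hθ1, h⟩ := H R
  have hθ0 : 0 ≤ θ := by linarith
  obtain ⟨M, hM⟩ := exists_norm_setAverage_ball_le hf R (r₀ * (1 / 2) ^ (0 + 1))
  set τ := √θ with hτ
  have hτ1 : τ < 1 := hsqrt1 hθ1
  have hτ2 : 1 / 2 ≤ τ := Real.le_sqrt_of_sq_le (by linarith)
  have hτ0 : 0 < τ := by linarith
  have hτ3 : 0 < 1 - τ := by linarith
  have happrox : ∀ x ∈ K, ∀ k, dist (u (k + 1) x) (g x) ≤ 9 * √C * τ ^ k / (1 - τ) :=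
    fun x hx => dist_le_of_le_geometric_of_tendsto τ (9 * √C) hτ1
      (hdist hC hθ0 (h x (hR hx))) (hg x)
  set E : ℝ := 18 * √C / (1 - τ) + 2 * √C with hE
  have hnear : ∀ x ∈ K, ∀ y ∈ K, ∀ k : ℕ, dist x y ≤ r₀ * (1 / 2) ^ (k + 1) →
      dist (g x) (g y) ≤ E * τ ^ k := by
    intro x hx y hy k hxy
    have h1 := happrox x hx k
    have h2 := happrox y hy k
    have h3 := norm_setAverage_ball_sub_setAverage_ball_le hG hG2 (hr (k + 1)) hxy
    rw [show 2 * (r₀ * (1 / 2) ^ (k + 1)) = r₀ * (1 / 2) ^ k by ring, ← dist_eq_norm] at h3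
    have h4 := hstep hC hθ0 (h y (hR hy)) k
    have h5 := dist_triangle4 (g x) (u (k + 1) x) (u (k + 1) y) (g y)
    rw [dist_comm (g x) (u (k + 1) x)] at h5
    change dist (u (k + 1) x) (u (k + 1) y) ≤ _ at h3
    rw [← hτ] at h4
    have h6 : E * τ ^ k = 9 * √C * τ ^ k / (1 - τ) + 2 * (√C * τ ^ k)
        + 9 * √C * τ ^ k / (1 - τ) := by
      rw [hE]
      ring
    linarith
  set B : ℝ := M + 9 * √C * τ ^ 0 / (1 - τ) with hB
  have hbound : ∀ x ∈ K, ‖g x‖ ≤ B := by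
    intro x hx
    have h1 := happrox x hx 0
    have h2 : ‖u (0 + 1) x‖ ≤ M := hM x (hR hx)
    have h3 := norm_le_norm_add_norm_sub (u (0 + 1) x) (g x)
    rw [dist_eq_norm] at h1
    linarith
  have hE0 : 0 ≤ E := by positivity
  -- Chosen so that (1/2)^α = τ. The lower bound θ ≥ 1/4 gives τ ≥ 1/2, hence α ≤ 1.
  set α := Real.log τ / Real.log (1 / 2) with hα
  have hlog : Real.log (1 / 2) < 0 := Real.log_neg (by norm_num) (by norm_num)
  have hα0 : 0 < α := div_pos_of_neg_of_neg (Real.log_neg hτ0 hτ1) hlog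
  have hα1 : α ≤ 1 := by
    rw [hα, div_le_one_of_neg hlog]
    exact Real.log_le_log (by norm_num) hτ2
  have hpow : (1 / 2 : ℝ) ^ α = τ := by
    rw [Real.rpow_def_of_pos (by norm_num), hα, mul_div_cancel₀ _ hlog.ne, Real.exp_log hτ0]
  refine ⟨((E + 2 * |B|) * (4 / r₀) ^ α).toNNReal, α.toNNReal, by simpa using hα0,
    by simpa using hα1, HolderOnWith.of_dist_le hα0.le fun x hx y hy => ?_⟩
  rw [mul_assoc, ← Real.mul_rpow (by positivity) dist_nonneg]
  have hp0 : 0 ≤ (4 / r₀ * dist x y) ^ α := by positivity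
  -- Near points are compared at the dyadic scale k with (1/2)^k < 4 dist x y / r₀. For far points 4
  -- dist x y / r₀ ≥ 1, and boundedness of g on K suffices.
  rcases le_or_gt (dist x y) (r₀ / 2) with hle | hgt
  · rcases (dist_nonneg (x := x) (y := y)).eq_or_lt with h0 | hpos
    · rw [eq_of_dist_eq_zero h0.symm, dist_self]
      positivity
    obtain ⟨k, hk1, hk2⟩ := exists_nat_pow_near_of_lt_one (x := dist x y / (r₀ / 2))
      (y := (1 / 2 : ℝ)) (by positivity) ((div_le_one (by positivity)).2 hle) (by norm_num)
      (by norm_num)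
    rw [div_le_iff₀ (by positivity)] at hk2
    have h1 := hnear x hx y hy k (by
      rw [pow_succ]
      linarith)
    have h2 : τ ^ k ≤ (4 / r₀ * dist x y) ^ α := by
      rw [← hpow, ← Real.rpow_natCast, ← Real.rpow_mul (by norm_num), mul_comm α,
        Real.rpow_mul (by norm_num), Real.rpow_natCast]
      gcongr
      rw [pow_succ] at hk1
      have : 4 / r₀ * dist x y = 2 * (dist x y / (r₀ / 2)) := by
        field_simp
        norm_num
      rw [this]
      linarith
    calc dist (g x) (g y) ≤ E * τ ^ k := h1
      _ ≤ E * (4 / r₀ * dist x y) ^ α := by gcongr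
      _ ≤ _ := by
        gcongr
        linarith [abs_nonneg B]
  · have h1 : 1 ≤ (4 / r₀ * dist x y) ^ α := by
      refine Real.one_le_rpow ?_ hα0.le
      rw [div_mul_eq_mul_div, one_le_div hr₀]
      linarith
    have h2 : dist (g x) (g y) ≤ 2 * |B| := by
      rw [dist_eq_norm]
      have := norm_sub_le (g x) (g y)
      linarith [hbound x hx, hbound y hy, le_abs_self B]
    calc dist (g x) (g y) ≤ (E + 2 * |B|) * 1 := by linarith
      _ ≤ _ := by gcongr

end Morrey

/-! ### The regularity theorem -/

theorem theorem7p1 {F : Type*} [NormedAddCommGroup F] [InnerProductSpace ℝ F]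
    [FiniteDimensional ℝ F]
    (f : Plane → F) (hf : MemHatW12 f)
    (G : Fin 2 → Plane → F) (hG : IsWeakGradient f G)
    (μ c₀ c₁ : ℝ) (hμ : μ ∈ Set.Ioo (0 : ℝ) 1) (hc₀ : 0 < c₀) (hc₁ : 0 < c₁)
    (h : ∀ (x₀ : Plane) (r : ℝ), 0 < r → r < 1 / 2 →
      ∫ x in ball x₀ (r / 2), gradSq G x ≤
        c₀ * (1 + ‖⨍ x in ball x₀ r, f x‖) * (∫ x in ball x₀ r \ ball x₀ (r / 2), gradSq G x)
          + c₁ * r ^ μ) :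
    ∃ g : Plane → F, f =ᵐ[volume] g ∧ IsLocallyHolder g := by
  have : CompleteSpace F := FiniteDimensional.complete ℝ F
  have hG2 : ∀ i, MemLp (G i) 2 volume := hG.memLp hf
  have hint := integrable_gradSq hG2
  have hfl := hf.1.locallyIntegrable
  -- Makes c₀ · 9√ε = 1/5, the slope that the polynomial decay tolerates.
  set ε : ℝ := (1 / (45 * c₀)) ^ 2 with hε
  obtain ⟨r₀, hr₀, hr₀', hsmall⟩ := exists_forall_setIntegral_ball_le hint
    (ε := ε) (by positivity) (by norm_num : (0 : ℝ) < 1 / 2)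
  refine exists_isLocallyHolder_of_gradSq_decay hG hG2 hr₀ fun R => ?_
  -- The means at the first two scales need separate bounds: the step from k + 1 to k + 2 uses the
  -- ball of index k, so no step leads from index 0 to index 1.
  obtain ⟨M₀, hM₀⟩ := exists_norm_setAverage_ball_le hfl R r₀
  obtain ⟨M₁, hM₁⟩ := exists_norm_setAverage_ball_le hfl R (r₀ / 2)
  obtain ⟨C, θ, hC, hθ, hθ1, hdecay⟩ := exists_geometric_decay_of_hole_filling
    (c := c₁ * r₀ ^ μ) (q := (1 / 2) ^ μ) (b := 9) (M₀ := max 0 (max M₀ M₁)) (ε := ε) (c₀ := c₀)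
    (by positivity) (by positivity) (Real.rpow_lt_one (by norm_num) (by norm_num) hμ.1)
    (by norm_num) (le_max_left _ _) hc₀.le (by
      rw [hε, Real.sqrt_sq (by positivity)]
      field_simp
      norm_num)
  refine ⟨C, θ, hC, hθ, hθ1, fun x hx => ?_⟩
  have hr : ∀ k : ℕ, 0 < r₀ * (1 / 2) ^ k := fun k => by positivity
  have hrle : ∀ k : ℕ, r₀ * (1 / 2) ^ k ≤ r₀ := fun k =>
    mul_le_of_le_one_right hr₀.le (pow_le_one₀ (by norm_num) (by norm_num))
  refine hdecay (fun k => ∫ z in ball x (r₀ * (1 / 2) ^ k), gradSq G z)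
    (fun k => ‖⨍ z in ball x (r₀ * (1 / 2) ^ k), f z‖)
    (fun k => integral_nonneg (gradSq_nonneg G)) (fun k => ?_) (fun k => norm_nonneg _) ?_ ?_
    (fun k => ?_) (fun k => ?_)
  · exact (setIntegral_mono_set hint.integrableOn (.of_forall (gradSq_nonneg G))
      (ball_subset_ball (hrle k)).eventuallyLE).trans (hsmall x)
  · rw [pow_zero, mul_one]
    exact (hM₀ x hx).trans ((le_max_left _ _).trans (le_max_right _ _))
  · rw [pow_one, mul_one_div]
    exact (hM₁ x hx).trans ((le_max_right _ _).trans (le_max_right _ _))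
  · have h1 := norm_setAverage_ball_half_sub_le hG hG2 x (hr (k + 1))
    rw [show r₀ * (1 / 2) ^ (k + 1) / 2 = r₀ * (1 / 2) ^ (k + 2) by ring,
      show 2 * (r₀ * (1 / 2) ^ (k + 1)) = r₀ * (1 / 2) ^ k by ring] at h1
    have h2 := norm_le_norm_add_norm_sub' (⨍ z in ball x (r₀ * (1 / 2) ^ (k + 2)), f z)
      (⨍ z in ball x (r₀ * (1 / 2) ^ (k + 1)), f z)
    exact h2.trans (add_le_add_right h1 _)
  · have h1 := h x _ (hr k) ((hrle k).trans_lt hr₀')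
    -- The annulus integral is d_k - d_{k+1}, and the source becomes c₁ r₀^μ ((1/2)^μ)^k.
    rw [setIntegral_sdiff measurableSet_ball hint.integrableOn
      (ball_subset_ball (by linarith [hr k])),
      show r₀ * (1 / 2) ^ k / 2 = r₀ * (1 / 2) ^ (k + 1) by ring,
      Real.mul_rpow hr₀.le (by positivity), ← Real.rpow_natCast (1 / 2) k,
      ← Real.rpow_mul (by norm_num), mul_comm (k : ℝ) μ, Real.rpow_mul (by norm_num),
      Real.rpow_natCast, Real.rpow_natCast, ← mul_assoc c₁] at h1
    exact h1
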